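/- Let $\mathcal F\subset\mathcal P(\omega)$ be a free filter, that is, a proper filter that contains every cofinite subset of $\omega$. Let $\xi(\mathcal F)=\omega\cup\{\infty\}$ be the space in which every point of $\omega$ is isolated and the neighborhoods of $\infty$ are the sets $\{\infty\}\cup A$ with $A\in\mathcal F$. Let $2^\omega$ be the Cantor set (the product of countably many copies of the discrete space $2=\{0,1\}$), and let $C_p(\xi(\mathcal F),2^\omega)$ be the set of continuous functions $\xi(\mathcal F)\to 2^\omega$ with the topology of pointwise convergence, i.e. as a subspace of the product $(2^\omega)^{\xi(\mathcal F)}$. Then $C_p(\xi(\mathcal F),2^\omega)$ is countable dense homogeneous if and only if $\mathcal F$ is a non-meager $P$-filter. Here a topological space $X$ is countable dense homogeneous if it is separable and for all countable dense $D,E\subset X$ there is a homeomorphism $h\colon X\to X$ with $h[D]=E$. The filter $\mathcal F$ is non-meager if the set of characteristic functions of its members is not a meager subset of $2^\omega$. It is a $P$-filter if for every sequence $(F_n)_{n<\omega}$ of members of $\mathcal F$ there is $F\in\mathcal F$ such that $F\setminus F_n$ is finite for all $n<\omega$. -/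

import Mathlib

/-- A topological space is countable dense homogeneous if it is separable and any two of its
countable dense subsets are matched by a self-homeomorphism. -/
def IsCountableDenseHomogeneous (X : Type*) [TopologicalSpace X] : Prop :=
  TopologicalSpace.SeparableSpace X ∧
    ∀ D E : Set X, D.Countable → Dense D → E.Countable → Dense E → ∃ h : X ≃ₜ X, h '' D = E

/-- The underlying set `ω ∪ {∞}` of the space `ξ(F)`; the point `∞` is `none`. -/
def Xi (_F : Filter ℕ) : Type := Option ℕ

/-- The point at infinity of `ξ(F)`. -/
def Xi.infty (F : Filter ℕ) : Xi F := (none : Option ℕ)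

/-- The inclusion of `ω` in `ξ(F)`. -/
def Xi.ofNat (F : Filter ℕ) (n : ℕ) : Xi F := some n

/-- A set `U` is open in `ξ(F)` iff `∞ ∈ U` implies `U ∩ ω ∈ F`. -/
instance Xi.topologicalSpace (F : Filter ℕ) : TopologicalSpace (Xi F) where
  IsOpen U := Xi.infty F ∈ U → Xi.ofNat F ⁻¹' U ∈ F
  isOpen_univ := fun _ => Filter.univ_mem
  isOpen_inter := fun _ _ hs ht h => Filter.inter_mem (hs h.1) (ht h.2)
  isOpen_sUnion := fun _ hS h => by
    obtain ⟨t, ht, hx⟩ := h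
    exact Filter.mem_of_superset (hS t ht hx) fun _ hn => ⟨t, ht, hn⟩

/-- Every point of `ω` is isolated in `ξ(F)`. -/
theorem Xi.isOpen_singleton_ofNat (F : Filter ℕ) (n : ℕ) :
    IsOpen ({Xi.ofNat F n} : Set (Xi F)) := by
  intro h
  cases h

/-- The neighborhoods of `∞` in `ξ(F)` are the sets `{∞} ∪ A` with `A ∈ F`. -/
theorem Xi.mem_nhds_infty (F : Filter ℕ) (U : Set (Xi F)) :
    U ∈ nhds (Xi.infty F) ↔ ∃ A ∈ F, U = insert (Xi.infty F) (Xi.ofNat F '' A) := by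
  have hinj : ∀ m n, Xi.ofNat F m = Xi.ofNat F n → m = n := fun _ _ h => Option.some.inj h
  have hne : ∀ n, Xi.ofNat F n ≠ Xi.infty F := fun n h => Option.some_ne_none n h
  constructor
  · intro h
    obtain ⟨V, hVU, hV, hmem⟩ := mem_nhds_iff.1 h
    refine ⟨Xi.ofNat F ⁻¹' U, Filter.mem_of_superset (hV hmem) fun _ hn => hVU hn, ?_⟩
    ext x
    cases x with
    | none => exact ⟨fun _ => Or.inl rfl, fun _ => hVU hmem⟩
    | some n =>
      refine ⟨fun hx => Or.inr ⟨n, hx, rfl⟩, ?_⟩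
      rintro (hx | ⟨m, hm, hx⟩)
      · exact absurd hx (hne n)
      · have hmn := hinj m n hx
        subst hmn
        exact hm
  · rintro ⟨A, hA, rfl⟩
    exact mem_nhds_iff.2 ⟨_, subset_rfl,
      fun _ => Filter.mem_of_superset hA fun n hn => Or.inr ⟨n, hn, rfl⟩, Or.inl rfl⟩

/-- `C_p(X, Y)`: the continuous functions `X → Y`, with the topology of pointwise convergence,
that is, as a subspace of the product `Y ^ X`. -/
abbrev Cp (X Y : Type*) [TopologicalSpace X] [TopologicalSpace Y] : Type _ :=
  {f : X → Y // Continuous f}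

/-- The set of characteristic functions of the members of `F`, a subset of the Cantor set. -/
def Filter.toCantorSet (F : Filter ℕ) : Set (ℕ → Bool) :=
  {x | {n | x n = true} ∈ F}

/-- A filter on `ω` is a `P`-filter if each sequence of its members has a pseudointersection
which is a member. -/
def Filter.IsPFilter (F : Filter ℕ) : Prop :=
  ∀ A : ℕ → Set ℕ, (∀ n, A n ∈ F) → ∃ B ∈ F, ∀ n, (B \ A n).Finite

/-! ### Invariance of countable dense homogeneity -/

/-! A continuous `f` from `ξ(F)` to `2^ω` is recorded, bit by bit, by its value at `∞` and by the
places where it agrees with that value. This makes the function space homeomorphic to the space of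
another free filter, `F.columns` (`cpHomeomorph`), so everything happens inside filters viewed as
subspaces of the Cantor set. Non-meagerness is used through a Talagrand-type consequence,
`Filter.AvoidsIntervals`, which passes to `F.columns`, as does the `P`-property.

Sufficiency: for countable dense `D` and `E`, the two properties give one member `C` of the filter
such that each point of `D ∪ E` is matched on `C` by points of either set that can be prescribed on
any finite set off `C` (`Filter.exists_mem_forall_fiber_dense`). A back-and-forth then pairs `D`
with `E` by an isometry that fixes all coordinates in `C`. It extends to a homeomorphism of `2^ω`,
and changes off `C` do not affect membership in the filter.

Necessity: enlarge a countable dense `D` by a countable `Q` and move `D ∪ Q` onto `D`. If the filter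
is meager, `D` can be chosen to meet each set of a nowhere dense closed cover in a finite set; with
`Q` dense in a Cantor set inside the filter this contradicts Baire. If it is not a `P`-filter, `Q`
can be closed and crowded and `D` the family of cofinite sets; interval avoidance forbids a closed
crowded set of cofinite sets. -/

theorem IsCountableDenseHomogeneous.of_homeomorph {X Y : Type*} [TopologicalSpace X]
    [TopologicalSpace Y] (φ : X ≃ₜ Y) (hX : IsCountableDenseHomogeneous X) :
    IsCountableDenseHomogeneous Y := by
  obtain ⟨hs, hX⟩ := hX
  refine ⟨φ.surjective.denseRange.separableSpace φ.continuous, fun D E hD hD' hE hE' => ?_⟩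
  obtain ⟨g, hg⟩ := hX (φ ⁻¹' D) (φ ⁻¹' E) (hD.preimage φ.injective) (hD'.preimage φ.isOpenMap)
    (hE.preimage φ.injective) (hE'.preimage φ.isOpenMap)
  refine ⟨φ.symm.trans (g.trans φ), ?_⟩
  have h : φ '' (g '' (φ.symm '' D)) = E := by
    rw [φ.symm.image_eq_preimage_symm, φ.symm_symm, hg, Set.image_preimage_eq _ φ.surjective]
  rw [← h, Set.image_image, Set.image_image]
  rfl

/-! ### Finite agreement in the Cantor set -/

theorem Dense.exists_agree {D : Set (ℕ → Bool)} (hD : Dense D) (x : ℕ → Bool) (n : ℕ) :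
    ∃ d ∈ D, ∀ m < n, d m = x m := by
  obtain ⟨d, hd, hdD⟩ := hD.inter_open_nonempty _ (PiNat.isOpen_cylinder (fun _ => Bool) x n)
    ⟨x, PiNat.self_mem_cylinder x n⟩
  exact ⟨d, hdD, PiNat.mem_cylinder_iff.1 hd⟩

theorem IsOpen.exists_agree_subset {U : Set (ℕ → Bool)} (hU : IsOpen U) {x : ℕ → Bool}
    (hx : x ∈ U) : ∃ n, ∀ y : ℕ → Bool, (∀ m < n, y m = x m) → y ∈ U := by
  obtain ⟨_, ⟨z, n, rfl⟩, hxz, hzU⟩ :=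
    (PiNat.isTopologicalBasis_cylinders (fun _ : ℕ => Bool)).exists_subset_of_mem_open hx hU
  refine ⟨n, fun y hy => hzU ?_⟩
  rw [PiNat.mem_cylinder_iff] at hxz ⊢
  exact fun m hm => (hy m hm).trans (hxz m hm)

theorem dense_of_exists_agree {D : Set (ℕ → Bool)}
    (h : ∀ (x : ℕ → Bool) (n : ℕ), ∃ d ∈ D, ∀ m < n, d m = x m) : Dense D := by
  refine dense_iff_inter_open.2 fun U hU ⟨x, hx⟩ => ?_
  obtain ⟨n, hn⟩ := hU.exists_agree_subset hx
  obtain ⟨d, hd, hdn⟩ := h x n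
  exact ⟨d, hn d hdn, hd⟩

theorem finite_setOf_forall_ge {α : Type*} [Finite α] (c : α) (N : ℕ) :
    {x : ℕ → α | ∀ m, N ≤ m → x m = c}.Finite := by
  refine Set.Finite.of_injOn (f := fun (x : ℕ → α) (i : Fin N) => x i) (t := Set.univ)
    (fun _ _ => Set.mem_univ _) (fun x hx y hy hxy => ?_) Set.finite_univ
  funext m
  by_cases hm : m < N
  · exact congrFun hxy ⟨m, hm⟩
  · rw [hx m (not_lt.1 hm), hy m (not_lt.1 hm)]

theorem countable_eventually_eq {α : Type*} [Finite α] (c : α) :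
    {x : ℕ → α | ∃ N, ∀ m, N ≤ m → x m = c}.Countable := by
  rw [Set.ofPred_exists]
  exact Set.countable_iUnion fun N => (finite_setOf_forall_ge c N).countable

/-! ### Filters on `ℕ` as subspaces of the Cantor set -/

theorem Filter.mem_of_forall_ge {F : Filter ℕ} (hF : F ≤ Filter.cofinite) {A : Set ℕ} {N : ℕ}
    (hA : ∀ m, N ≤ m → m ∈ A) : A ∈ F := by
  refine hF (Filter.mem_cofinite.2 ((Set.finite_lt_nat N).subset fun m hm => ?_))
  exact not_le.1 fun h => hm (hA m h)

theorem Filter.dense_toCantorSet {F : Filter ℕ} (hF : F ≤ Filter.cofinite) :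
    Dense F.toCantorSet := by
  refine dense_of_exists_agree fun x n =>
    ⟨fun m => if m < n then x m else true, ?_, fun m hm => if_pos hm⟩
  exact Filter.mem_of_forall_ge hF (N := n) fun m hm =>
    if_neg (not_lt.2 hm)

/-- A filter avoids intervals if, for each assignment `N ↦ [N, g N)`, it has a member that is
disjoint from infinitely many of these intervals. -/
def Filter.AvoidsIntervals (F : Filter ℕ) : Prop :=
  ∀ g : ℕ → ℕ, ∃ A ∈ F, ∀ n, ∃ N, n ≤ N ∧ ∀ m ∈ A, N ≤ m → g N ≤ m

/-- If `g` failed, each member would meet `[N, g N)` for all large `N`. The points with a one in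
every such interval from some stage on form a meager set, since any initial segment can be followed
by zeros. -/
theorem Filter.avoidsIntervals_of_not_isMeagre {F : Filter ℕ} (hF : ¬ IsMeagre F.toCantorSet) :
    F.AvoidsIntervals := by
  intro g
  by_contra! hg
  let T : ℕ → Set (ℕ → Bool) := fun n => ⋂ N ∈ Set.Ici n, ⋃ m ∈ Set.Ico N (g N), {x | x m = true}
  refine hF (IsMeagre.mono (s := ⋃ n, T n) (fun x hx => ?_) (isMeagre_iUnion fun n => ?_))
  · obtain ⟨n, hn⟩ := hg _ hx
    refine Set.mem_iUnion.2 ⟨n, Set.mem_iInter₂.2 fun N hN => ?_⟩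
    obtain ⟨m, hm, hNm, hmg⟩ := hn N hN
    exact Set.mem_iUnion₂.2 ⟨m, ⟨hNm, hmg⟩, hm⟩
  · refine IsNowhereDense.isMeagre ?_
    have hc : IsClosed (T n) := by
      refine isClosed_biInter fun N _ => (Set.finite_Ico N (g N)).isClosed_biUnion fun m _ => ?_
      exact isClosed_eq (continuous_apply m) continuous_const
    rw [hc.isNowhereDense_iff, Set.eq_empty_iff_forall_notMem]
    intro x hx
    obtain ⟨k, hk⟩ := isOpen_interior.exists_agree_subset hx
    have := interior_subset (hk (fun m => if m < k then x m else false) fun m hm => if_pos hm)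
    obtain ⟨m, hm, hmx⟩ := Set.mem_iUnion₂.1
      (Set.mem_iInter₂.1 this (max n k) (Set.mem_Ici.2 (le_max_left n k)))
    have hkm : ¬ m < k := not_lt.2 ((le_max_right n k).trans hm.1)
    simp [hkm] at hmx

/-! ### The filter of families of members -/

/-- The identification of `ℕ × Option ℕ` with `ℕ`. -/
def columnIndex : ℕ × Option ℕ ≃ ℕ := Denumerable.eqv (ℕ × Option ℕ)

/-- The filter on `ℕ`, identified with `ℕ × Option ℕ`, of the sets all of whose columns have
their trace on `ℕ` in `F`. -/
def Filter.columns (F : Filter ℕ) : Filter ℕ :=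
  ⨆ k : ℕ, F.map fun n => columnIndex (k, some n)

theorem Filter.mem_columns {F : Filter ℕ} {A : Set ℕ} :
    A ∈ F.columns ↔ ∀ k, {n | columnIndex (k, some n) ∈ A} ∈ F :=
  Filter.mem_iSup

theorem columnIndex_some_injective (k : ℕ) :
    Function.Injective fun n => columnIndex (k, some n) :=
  fun m n h => by simpa using columnIndex.injective h

theorem Filter.columns_le_cofinite {F : Filter ℕ} (hF : F ≤ Filter.cofinite) :
    F.columns ≤ Filter.cofinite :=
  iSup_le fun k => (Filter.map_mono hF).trans (columnIndex_some_injective k).tendsto_cofinite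

/-- The set of the points of all columns at natural numbers. -/
theorem Filter.range_mem_columns (F : Filter ℕ) :
    Set.range (fun p : ℕ × ℕ => columnIndex (p.1, some p.2)) ∈ F.columns :=
  Filter.mem_columns.2 fun k => Filter.mem_of_superset Filter.univ_mem fun n _ => ⟨(k, n), rfl⟩

/-- The unconstrained coordinates `(k, none)` leave room for a Cantor set of members in
`IsCountableDenseHomogeneous.not_isMeagre`. -/
theorem infinite_compl_range_columnIndex :
    (Set.range fun p : ℕ × ℕ => columnIndex (p.1, some p.2))ᶜ.Infinite := by
  refine (Set.infinite_range_of_injective (f := fun k : ℕ => columnIndex (k, none))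
    fun k l h => by simpa using columnIndex.injective h).mono ?_
  rintro _ ⟨k, rfl⟩ ⟨p, hp⟩
  simpa using columnIndex.injective hp

theorem Continuous.bool_beq {X : Type*} [TopologicalSpace X] {f g : X → Bool}
    (hf : Continuous f) (hg : Continuous g) : Continuous fun x => f x == g x :=
  (continuous_of_discreteTopology (f := fun b : Bool × Bool => b.1 == b.2)).comp (hf.prodMk hg)

/-- The space of continuous functions `ξ(F) → 2^ω` is the space of a filter: the value at `n` is recorded by the
coordinates where it agrees with the value at `∞`. -/
def cpHomeomorph (F : Filter ℕ) : Cp (Xi F) (ℕ → Bool) ≃ₜ F.columns.toCantorSet where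
  toFun f := ⟨fun j => match columnIndex.symm j with
    | (k, none) => f.1 (Xi.infty F) k
    | (k, some n) => f.1 (Xi.ofNat F n) k == f.1 (Xi.infty F) k, by
      refine Filter.mem_columns.2 fun k => ?_
      have hc : Continuous fun p : Xi F => f.1 p k := (continuous_apply k).comp f.2
      have := hc.isOpen_preimage {f.1 (Xi.infty F) k} (isOpen_discrete _) rfl
      refine Filter.mem_of_superset this fun n hn => ?_
      have hn' : f.1 (Xi.ofNat F n) k = f.1 (Xi.infty F) k := hn
      simp [hn']⟩
  invFun x := ⟨fun p k => match (p : Option ℕ) with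
    | none => x.1 (columnIndex (k, none))
    | some n => x.1 (columnIndex (k, some n)) == x.1 (columnIndex (k, none)), by
      refine continuous_pi fun k => ⟨fun U _ hU => ?_⟩
      refine Filter.mem_of_superset (Filter.mem_columns.1 x.2 k) fun n hn => ?_
      have hn' : x.1 (columnIndex (k, some n)) = true := hn
      change (x.1 (columnIndex (k, some n)) == x.1 (columnIndex (k, none))) ∈ U
      rw [hn', Bool.true_beq]
      exact hU⟩
  left_inv f := by
    ext p k
    rcases p with _ | n
    · simp; rfl
    · simp; rfl
  right_inv x := by
    ext j
    obtain ⟨⟨k, _ | n⟩, rfl⟩ := columnIndex.surjective j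
    · simp; rfl
    · simp only [Equiv.symm_apply_apply]
      change ((x.1 (columnIndex (k, some n)) == x.1 (columnIndex (k, none))) ==
        x.1 (columnIndex (k, none))) = x.1 (columnIndex (k, some n))
      cases x.1 (columnIndex (k, some n)) <;> cases x.1 (columnIndex (k, none)) <;> rfl
  continuous_toFun := by
    refine Continuous.subtype_mk (continuous_pi fun j => ?_) _
    obtain ⟨⟨k, _ | n⟩, rfl⟩ := columnIndex.surjective j
    · simp only [Equiv.symm_apply_apply]
      exact (continuous_apply k).comp ((continuous_apply _).comp continuous_subtype_val)
    · simp only [Equiv.symm_apply_apply]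
      exact ((continuous_apply k).comp ((continuous_apply _).comp continuous_subtype_val)).bool_beq
        ((continuous_apply k).comp ((continuous_apply _).comp continuous_subtype_val))
  continuous_invFun := by
    refine Continuous.subtype_mk (continuous_pi fun p => continuous_pi fun k => ?_) _
    rcases p with _ | n
    · exact (continuous_apply _).comp continuous_subtype_val
    · exact ((continuous_apply _).comp continuous_subtype_val).bool_beq
        ((continuous_apply _).comp continuous_subtype_val)

theorem Filter.isMeagre_columns {F : Filter ℕ} (hF : IsMeagre F.toCantorSet) :
    IsMeagre F.columns.toCantorSet := by
  let φ : ℕ → ℕ := fun n => columnIndex (0, some n)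
  have hφ : Function.Injective φ := columnIndex_some_injective 0
  have hc : Continuous fun x : ℕ → Bool => x ∘ φ :=
    continuous_pi fun n => continuous_apply (φ n)
  refine (hF.preimage_of_isOpenMap hc (IsOpenMap.of_sections fun x => ?_)).mono
    fun x hx => Filter.mem_columns.1 hx 0
  -- A section through `x`: overwrite column `0` and keep the rest of `x`.
  refine ⟨fun z => Function.extend φ z x, Continuous.continuousAt (continuous_pi fun n => ?_), ?_,
    fun z => Function.extend_comp hφ z x⟩
  · by_cases hn : ∃ m, φ m = n
    · obtain ⟨m, rfl⟩ := hn
      simpa only [hφ.extend_apply] using continuous_apply m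
    · simpa only [Function.extend_apply' _ _ _ hn] using continuous_const
  · funext n
    by_cases hn : ∃ m, φ m = n
    · obtain ⟨m, rfl⟩ := hn
      simp only [hφ.extend_apply, Function.comp_apply]
    · simp only [Function.extend_apply' _ _ _ hn]

/-- Copy one `B` into all columns, cutting column `k` below `b a` for `a < k`. When `B` misses `[a,
b a)`, a point of index below `g (N a)` has `n < b a`; the cut then gives `k ≤ a` and the gap gives
`n < a`, so its index is below `N a`. -/
theorem Filter.AvoidsIntervals.columns {F : Filter ℕ} (hF : F ≤ Filter.cofinite)
    (h : F.AvoidsIntervals) : F.columns.AvoidsIntervals := by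
  intro g
  have hN : ∀ a : ℕ, ∃ N, a ≤ N ∧ ∀ k ≤ a, ∀ n < a, columnIndex (k, some n) < N := by
    intro a
    obtain ⟨N, hN⟩ := (((Set.finite_le_nat a).prod (Set.finite_lt_nat a)).image
      fun p : ℕ × ℕ => columnIndex (p.1, some p.2)).bddAbove
    refine ⟨max a (N + 1), le_max_left _ _, fun k hk n hn => ?_⟩
    exact lt_max_of_lt_right (Nat.lt_succ_of_le (hN ⟨(k, n), ⟨hk, hn⟩, rfl⟩))
  choose N haN hN using hN
  have hb : ∀ a : ℕ, ∃ b, ∀ k n, columnIndex (k, some n) < g (N a) → n < b := by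
    intro a
    have hinj : Function.Injective fun p : ℕ × ℕ => columnIndex (p.1, some p.2) := by
      rintro ⟨k, n⟩ ⟨l, m⟩ hp
      simpa using columnIndex.injective hp
    obtain ⟨b, hb⟩ := (((Set.finite_lt_nat (g (N a))).preimage hinj.injOn).image
      Prod.snd).bddAbove
    exact ⟨b + 1, fun k n hkn => Nat.lt_succ_of_le (hb ⟨(k, n), hkn, rfl⟩)⟩
  choose b hb using hb
  obtain ⟨B, hB, hBb⟩ := h b
  refine ⟨{j | ∃ k, ∃ n ∈ B, (∀ a < k, b a ≤ n) ∧ columnIndex (k, some n) = j},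
    Filter.mem_columns.2 fun k => ?_, fun n => ?_⟩
  · have hk : {n | ∀ a < k, b a ≤ n} ∈ F := by
      obtain ⟨M, hM⟩ := ((Set.finite_lt_nat k).image b).bddAbove
      exact Filter.mem_of_forall_ge hF (N := M) fun m hm a ha => (hM ⟨a, ha, rfl⟩).trans hm
    filter_upwards [hB, hk] with n hn hkn using ⟨k, n, hn, hkn, rfl⟩
  · obtain ⟨a, hna, ha⟩ := hBb n
    refine ⟨N a, hna.trans (haN a), ?_⟩
    rintro _ ⟨k, m, hm, hkm, rfl⟩ hle
    by_contra! hlt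
    have hmb := hb a k m hlt
    have hka : k ≤ a := not_lt.1 fun hak => (hkm a hak).not_gt hmb
    have ham : a ≤ m := not_lt.1 fun hma => (hN a k hka m hma).not_ge hle
    exact (ha m hm ham).not_gt hmb

/-- Diagonalization: column `k` is trimmed into `A i` for all `i ≤ k`, so only the finitely many
columns `k < i` can leave `A i`, each at finitely many points. -/
theorem Filter.IsPFilter.columns {F : Filter ℕ} (hF : F ≤ Filter.cofinite) (h : F.IsPFilter) :
    F.columns.IsPFilter := by
  intro A hA
  obtain ⟨B, hB, hBA⟩ := h
    (fun i => {n | columnIndex (i.unpair.2, some n) ∈ A i.unpair.1})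
    fun i => Filter.mem_columns.1 (hA _) _
  replace hBA : ∀ i k, (B \ {n | columnIndex (k, some n) ∈ A i}).Finite := fun i k => by
    simpa using hBA (Nat.pair i k)
  refine ⟨{j | ∃ k, ∃ n ∈ B, (∀ i ≤ k, columnIndex (k, some n) ∈ A i) ∧
    columnIndex (k, some n) = j}, Filter.mem_columns.2 fun k => ?_, fun i => ?_⟩
  · have hk : (⋃ i ∈ Set.Iic k, B \ {n | columnIndex (k, some n) ∈ A i}).Finite :=
      (Set.finite_Iic k).biUnion fun i _ => hBA i k
    filter_upwards [hB, hF hk.compl_mem_cofinite] with n hn hkn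
    refine ⟨k, n, hn, fun i hi => ?_, rfl⟩
    by_contra hni
    exact hkn (Set.mem_iUnion₂.2 ⟨i, hi, hn, hni⟩)
  · refine ((Set.finite_Iio i).biUnion fun k _ =>
      (hBA i k).image fun n => columnIndex (k, some n)).subset ?_
    rintro _ ⟨⟨k, n, hn, hkn, rfl⟩, hni⟩
    exact Set.mem_iUnion₂.2 ⟨k, not_le.1 fun hik => hni (hkn i hik), n, ⟨hn, hni⟩, rfl⟩

theorem Filter.IsPFilter.of_columns {F : Filter ℕ} (h : F.columns.IsPFilter) : F.IsPFilter := by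
  intro A hA
  obtain ⟨B, hB, hBA⟩ := h (fun i => {j | ∃ k, ∃ n ∈ A i, columnIndex (k, some n) = j})
    fun i => Filter.mem_columns.2 fun k =>
      Filter.mem_of_superset (hA i) fun n hn => ⟨k, n, hn, rfl⟩
  refine ⟨_, Filter.mem_columns.1 hB 0, fun i => ?_⟩
  refine ((hBA i).preimage (columnIndex_some_injective 0).injOn).subset ?_
  rintro n ⟨hn, hni⟩
  refine ⟨hn, ?_⟩
  rintro ⟨k, m, hm, hkm⟩
  have : k = 0 ∧ m = n := by simpa using columnIndex.injective hkm
  exact hni (this.2 ▸ hm)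

/-! ### Countable dense subsets of non-meager `P`-filters -/

theorem Filter.exists_mem_forall_fiber_dense {F : Filter ℕ} (hT : F.AvoidsIntervals)
    (hP : F.IsPFilter) {ι : Type*} [Finite ι] [Nonempty ι] {D : ι → Set (ℕ → Bool)}
    (hDF : ∀ i, D i ⊆ F.toCantorSet) (hDc : ∀ i, (D i).Countable) (hDd : ∀ i, Dense (D i)) :
    ∃ C ∈ F, ∀ i j, ∀ d ∈ D i, ∀ (n : ℕ) (t : ℕ → Bool),
      ∃ e ∈ D j, (∀ m ∈ C, d m = e m) ∧ ∀ m < n, m ∉ C → e m = t m := by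
  obtain ⟨u, hu⟩ := (Set.countable_iUnion hDc).exists_eq_range
    (Set.nonempty_iUnion.2 ⟨Classical.arbitrary ι, (hDd _).nonempty⟩)
  have huF : ∀ j, u j ∈ F.toCantorSet := fun j => by
    obtain ⟨i, hi⟩ := Set.mem_iUnion.1 (hu.symm ▸ Set.mem_range_self j : u j ∈ ⋃ i, D i)
    exact hDF i hi
  obtain ⟨B, hB, hBu⟩ := hP (fun j => {m | u j m = true}) huF
  have hbd : ∀ j, ∃ b, ∀ m ∈ B, b ≤ m → u j m = true := fun j => by
    obtain ⟨b, hb⟩ := (hBu j).bddAbove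
    refine ⟨b + 1, fun m hm hbm => ?_⟩
    by_contra hne
    exact absurd (hb ⟨hm, hne⟩) (by omega)
  choose b hb using hbd
  have hDu : ∀ i, ∀ d ∈ D i, ∃ j, u j = d := fun i d hd =>
    (hu ▸ Set.mem_iUnion.2 ⟨i, hd⟩ : d ∈ Set.range u)
  have hex : ∀ (i : ι) (x : ℕ → Bool) (N : ℕ), ∃ j, u j ∈ D i ∧ ∀ m < N, u j m = x m := by
    intro i x N
    obtain ⟨d, hd, hdx⟩ := (hDd i).exists_agree x N
    obtain ⟨j, rfl⟩ := hDu i d hd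
    exact ⟨j, hd, hdx⟩
  choose e heD hex using hex
  -- There are finitely many patterns below `N`, coded by extending them by zeros, so one bound
  -- serves all chosen realizations.
  have hg : ∀ N : ℕ, ∃ M, (∀ j ≤ N, b j ≤ M) ∧
      ∀ i, ∀ x : ℕ → Bool, (∀ m, N ≤ m → x m = false) → b (e i x N) ≤ M := by
    intro N
    obtain ⟨M₁, hM₁⟩ := ((Set.finite_le_nat N).image b).bddAbove
    obtain ⟨M₂, hM₂⟩ := (((Set.finite_univ (α := ι)).prod (finite_setOf_forall_ge false N)).image
      fun p : ι × (ℕ → Bool) => b (e p.1 p.2 N)).bddAbove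
    exact ⟨max M₁ M₂, fun j hj => le_max_of_le_left (hM₁ ⟨j, hj, rfl⟩),
      fun i x hx => le_max_of_le_right (hM₂ ⟨(i, x), ⟨trivial, hx⟩, rfl⟩)⟩
  choose g hg₁ hg₂ using hg
  obtain ⟨A, hA, hAg⟩ := hT g
  refine ⟨A ∩ B, Filter.inter_mem hA hB, fun i j d hd n t => ?_⟩
  obtain ⟨k, rfl⟩ := hDu i d hd
  obtain ⟨N, hnN, hN⟩ := hAg (max n k)
  classical
  let x : ℕ → Bool := fun m => if m < N then if m ∈ A ∩ B then u k m else t m else false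
  have hx : ∀ m < N, x m = if m ∈ A ∩ B then u k m else t m := fun m hm => if_pos hm
  refine ⟨u (e j x N), heD j x N, fun m hm => ?_, fun m hm hmC => ?_⟩
  · by_cases hmN : m < N
    · rw [hex j x N m hmN, hx m hmN, if_pos hm]
    -- Past the gap `[N, g N)` of `A`, both points are constantly one on `B`.
    · have hgm := hN m hm.1 (not_lt.1 hmN)
      rw [hb k m hm.2 ((hg₁ N k ((le_max_right n k).trans hnN)).trans hgm),
        hb _ m hm.2 ((hg₂ N j x fun m hm => if_neg (not_lt.2 hm)).trans hgm)]
  · have hmN : m < N := hm.trans_le ((le_max_left n k).trans hnN)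
    rw [hex j x N m hmN, hx m hmN, if_neg hmC]

/-! ### Back and forth -/

/-- A Rasiowa–Sikorski argument: an ideal meets countably many cofinal sets, and its directedness
puts any two pairs into one finite approximation. -/
theorem exists_set_of_finset_extension {α β : Type*} [Countable α] [Countable β]
    (P : Finset (α × β) → Prop) (h₀ : P ∅)
    (hl : ∀ p, P p → ∀ a, ∃ q, P q ∧ p ⊆ q ∧ ∃ b, (a, b) ∈ q)
    (hr : ∀ p, P p → ∀ b, ∃ q, P q ∧ p ⊆ q ∧ ∃ a, (a, b) ∈ q) :
    ∃ g : Set (α × β), (∀ a, ∃ b, (a, b) ∈ g) ∧ (∀ b, ∃ a, (a, b) ∈ g) ∧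
      ∀ u ∈ g, ∀ v ∈ g, ∃ p, P p ∧ u ∈ p ∧ v ∈ p := by
  cases nonempty_encodable α
  cases nonempty_encodable β
  let 𝒟 : α ⊕ β → Order.Cofinal {p // P p} := fun c => c.rec
    (fun a => ⟨{p | ∃ b, (a, b) ∈ p.1}, fun p => by
      obtain ⟨q, hq, hpq, h⟩ := hl p.1 p.2 a
      exact ⟨⟨q, hq⟩, h, hpq⟩⟩)
    (fun b => ⟨{p | ∃ a, (a, b) ∈ p.1}, fun p => by
      obtain ⟨q, hq, hpq, h⟩ := hr p.1 p.2 b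
      exact ⟨⟨q, hq⟩, h, hpq⟩⟩)
  let I := Order.idealOfCofinals ⟨∅, h₀⟩ 𝒟
  refine ⟨{u | ∃ p ∈ I, u ∈ p.1}, fun a => ?_, fun b => ?_, ?_⟩
  · obtain ⟨p, ⟨b, hb⟩, hp⟩ := Order.cofinal_meets_idealOfCofinals ⟨∅, h₀⟩ 𝒟 (Sum.inl a)
    exact ⟨b, p, hp, hb⟩
  · obtain ⟨p, ⟨a, ha⟩, hp⟩ := Order.cofinal_meets_idealOfCofinals ⟨∅, h₀⟩ 𝒟 (Sum.inr b)
    exact ⟨a, p, hp, ha⟩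
  · rintro u ⟨p, hp, hu⟩ v ⟨q, hq, hv⟩
    obtain ⟨r, -, hpr, hqr⟩ := I.directed p hp q hq
    exact ⟨r.1, r.2, hpr hu, hqr hv⟩

/-- A relation between points of the Cantor set is a partial isometry over `C` if it preserves
the length of the common initial segment of two points and does not change the coordinates
in `C`. -/
def IsPartialIsometryOver (C : Set ℕ) (p : Set ((ℕ → Bool) × (ℕ → Bool))) : Prop :=
  ∀ u ∈ p, (∀ m ∈ C, u.1 m = u.2 m) ∧
    ∀ v ∈ p, ∀ k, (∀ m < k, u.1 m = v.1 m) ↔ ∀ m < k, u.2 m = v.2 m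

theorem IsPartialIsometryOver.preimage_swap {C : Set ℕ} {p : Set ((ℕ → Bool) × (ℕ → Bool))}
    (hp : IsPartialIsometryOver C p) : IsPartialIsometryOver C (Prod.swap ⁻¹' p) :=
  fun _ hu => ⟨fun m hm => ((hp _ hu).1 m hm).symm, fun _ hv k => ((hp _ hu).2 _ hv k).symm⟩

theorem IsPartialIsometryOver.exists_insert {C : Set ℕ} {p : Set ((ℕ → Bool) × (ℕ → Bool))}
    (hp : IsPartialIsometryOver C p) (hfin : p.Finite) {E : Set (ℕ → Bool)}
    (hpE : ∀ u ∈ p, u.2 ∈ E) (d : ℕ → Bool)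
    (hE : ∀ (n : ℕ) (t : ℕ → Bool), ∃ e ∈ E, (∀ m ∈ C, d m = e m) ∧ ∀ m < n, m ∉ C → e m = t m) :
    ∃ e ∈ E, IsPartialIsometryOver C (insert (d, e) p) := by
  classical
  suffices h : ∃ e ∈ E, (∀ m ∈ C, d m = e m) ∧
      ∀ v ∈ p, ∀ k, (∀ m < k, d m = v.1 m) ↔ ∀ m < k, e m = v.2 m by
    obtain ⟨e, heE, hC, he⟩ := h
    refine ⟨e, heE, ?_⟩
    rintro u (rfl | hu)
    · refine ⟨hC, ?_⟩
      rintro v (rfl | hv) k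
      · simp
      · exact he v hv k
    · refine ⟨(hp u hu).1, ?_⟩
      rintro v (rfl | hv) k
      · have := he u hu k
        simpa only [eq_comm] using this
      · exact (hp u hu).2 v hv k
  by_cases hdp : ∃ e, (d, e) ∈ p
  · obtain ⟨e, he⟩ := hdp
    exact ⟨e, hpE _ he, (hp _ he).1, (hp _ he).2⟩
  rcases p.eq_empty_or_nonempty with rfl | hne
  · obtain ⟨e, heE, hC, -⟩ := hE 0 d
    exact ⟨e, heE, hC, by simp⟩
  have hne' : ∀ v ∈ p, d ≠ v.1 := fun v hv h => hdp ⟨v.2, h ▸ hv⟩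
  -- `w` is a nearest neighbor of `d` in the domain. It suffices that `e` branch off from `w.2`
  -- exactly at `n`; on `C` this is automatic, and off `C` it can be prescribed.
  obtain ⟨w, hw, hmax⟩ := hfin.exists_maximalFor (fun v => PiNat.firstDiff d v.1) p hne
  set n := PiNat.firstDiff d w.1 with hn
  have hmax' : ∀ v ∈ p, PiNat.firstDiff d v.1 ≤ n := fun v hv =>
    (le_total _ _).elim id fun h => hmax hv h
  have hdw : ∀ m < n, d m = w.1 m := fun m hm => PiNat.apply_eq_of_lt_firstDiff hm
  have hdn : d n ≠ w.1 n := PiNat.apply_firstDiff_ne (hne' w hw)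
  obtain ⟨e, heE, hC, het⟩ := hE (n + 1) fun m => if m < n then w.2 m else !w.2 n
  have hew : ∀ m < n, e m = w.2 m := fun m hm => by
    by_cases hmC : m ∈ C
    · rw [← hC m hmC, hdw m hm, (hp w hw).1 m hmC]
    · rw [het m (by omega) hmC, if_pos hm]
  have hen : e n ≠ w.2 n := by
    by_cases hnC : n ∈ C
    · rwa [← hC n hnC, ← (hp w hw).1 n hnC]
    · simp [het n (by omega) hnC]
  refine ⟨e, heE, hC, fun v hv k => ?_⟩
  have hwv := (hp w hw).2 v hv
  rcases le_or_gt k n with hk | hk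
  · calc (∀ m < k, d m = v.1 m) ↔ ∀ m < k, w.1 m = v.1 m :=
        forall₂_congr fun m hm => by rw [hdw m (hm.trans_le hk)]
      _ ↔ ∀ m < k, w.2 m = v.2 m := hwv k
      _ ↔ ∀ m < k, e m = v.2 m := forall₂_congr fun m hm => by rw [hew m (hm.trans_le hk)]
  · refine iff_of_false (fun h => ?_) fun h => ?_
    · exact PiNat.apply_firstDiff_ne (hne' v hv) (h _ ((hmax' v hv).trans_lt hk))
    · have h₁ : ∀ m < n, w.1 m = v.1 m :=
        (hwv n).2 fun m hm => (hew m hm).symm.trans (h m (hm.trans hk))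
      have h₂ : d n ≠ v.1 n := fun hdv => by
        refine PiNat.apply_firstDiff_ne (hne' v hv) ?_
        rcases (hmax' v hv).lt_or_eq with hlt | heq
        · rw [hdw _ hlt, h₁ _ hlt]
        · rw [heq, hdv]
      -- With two letters, values that both differ from `d n` are equal.
      have h₃ : w.1 n = v.1 n := by
        revert hdn h₂
        cases d n <;> cases w.1 n <;> cases v.1 n <;> simp
      have h₄ := (hwv (n + 1)).1 (fun m hm => by
        rcases (Nat.lt_succ_iff.1 hm).lt_or_eq with hlt | rfl
        · exact h₁ m hlt
        · exact h₃) n n.lt_succ_self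
      exact hen ((h n hk).trans h₄.symm)

theorem exists_isPartialIsometryOver {C : Set ℕ} {D E : Set (ℕ → Bool)} (hD : D.Countable)
    (hE : E.Countable)
    (hDE : ∀ d ∈ D, ∀ (n : ℕ) (t : ℕ → Bool),
      ∃ e ∈ E, (∀ m ∈ C, d m = e m) ∧ ∀ m < n, m ∉ C → e m = t m)
    (hED : ∀ d ∈ E, ∀ (n : ℕ) (t : ℕ → Bool),
      ∃ e ∈ D, (∀ m ∈ C, d m = e m) ∧ ∀ m < n, m ∉ C → e m = t m) :
    ∃ g : Set ((ℕ → Bool) × (ℕ → Bool)), IsPartialIsometryOver C g ∧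
      Prod.fst '' g = D ∧ Prod.snd '' g = E := by
  classical
  have := hD.to_subtype
  have := hE.to_subtype
  let φ : D × E → (ℕ → Bool) × (ℕ → Bool) := Prod.map Subtype.val Subtype.val
  obtain ⟨g, hgl, hgr, hg⟩ := exists_set_of_finset_extension (α := D) (β := E)
    (fun p => IsPartialIsometryOver C (φ '' p)) (by simp [IsPartialIsometryOver])
    (fun p hp d => by
      obtain ⟨e, he, h⟩ := hp.exists_insert (p.finite_toSet.image φ)
        (by rintro _ ⟨u, -, rfl⟩; exact u.2.2) d.1 (hDE _ d.2)
      refine ⟨insert (d, ⟨e, he⟩) p, ?_, Finset.subset_insert _ _, _, Finset.mem_insert_self _ _⟩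
      rwa [Finset.coe_insert, Set.image_insert_eq])
    (fun p hp e => by
      obtain ⟨d, hd, h⟩ := hp.preimage_swap.exists_insert
        ((p.finite_toSet.image φ).preimage Prod.swap_injective.injOn)
        (E := D) (by
          rintro u ⟨v, -, hv⟩
          have h : v.1.1 = u.2 := congrArg Prod.fst hv
          exact h ▸ v.1.2) e.1 (hED _ e.2)
      refine ⟨insert (⟨d, hd⟩, e) p, ?_, Finset.subset_insert _ _, _, Finset.mem_insert_self _ _⟩
      rw [Finset.coe_insert, Set.image_insert_eq]
      convert h.preimage_swap using 1
      ext u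
      simp [φ, Prod.ext_iff, and_comm])
  refine ⟨φ '' g, ?_, ?_, ?_⟩
  · rintro _ ⟨u, hu, rfl⟩
    constructor
    · obtain ⟨p, hp, hup, -⟩ := hg u hu u hu
      exact (hp _ ⟨u, hup, rfl⟩).1
    · rintro _ ⟨v, hv, rfl⟩
      obtain ⟨p, hp, hup, hvp⟩ := hg u hu v hv
      exact (hp _ ⟨u, hup, rfl⟩).2 _ ⟨v, hvp, rfl⟩
  · ext d
    constructor
    · rintro ⟨_, ⟨u, -, rfl⟩, rfl⟩
      exact u.1.2
    · intro hd
      obtain ⟨e, he⟩ := hgl ⟨d, hd⟩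
      exact ⟨_, ⟨_, he, rfl⟩, rfl⟩
  · ext e
    constructor
    · rintro ⟨_, ⟨u, -, rfl⟩, rfl⟩
      exact u.2.2
    · intro he
      obtain ⟨d, hd⟩ := hgr ⟨e, he⟩
      exact ⟨_, ⟨_, hd, rfl⟩, rfl⟩

/-- A partial isometry with dense domain extends to the Cantor set. -/
theorem IsPartialIsometryOver.exists_extension {C : Set ℕ} {g : Set ((ℕ → Bool) × (ℕ → Bool))}
    (hg : IsPartialIsometryOver C g) (hd : Dense (Prod.fst '' g)) :
    ∃ f : (ℕ → Bool) → ℕ → Bool, Continuous f ∧ (∀ x, ∀ m ∈ C, f x m = x m) ∧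
      ∀ x n, ∀ u ∈ g, (∀ m < n, u.1 m = x m) → ∀ m < n, f x m = u.2 m := by
  have hex : ∀ (x : ℕ → Bool) (n : ℕ), ∃ u ∈ g, ∀ m < n, u.1 m = x m := by
    intro x n
    obtain ⟨_, ⟨u, hu, rfl⟩, hux⟩ := hd.exists_agree x n
    exact ⟨u, hu, hux⟩
  choose u hu hux using hex
  have key : ∀ x n, ∀ v ∈ g, (∀ m < n, v.1 m = x m) → ∀ m < n, (u x (m + 1)).2 m = v.2 m := by
    intro x n v hv hvx m hm
    exact ((hg _ (hu x (m + 1))).2 v hv (m + 1)).1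
      (fun k hk => (hux x _ k hk).trans (hvx k (by omega)).symm) m m.lt_succ_self
  refine ⟨fun x m => (u x (m + 1)).2 m, continuous_pi fun m => ?_, fun x m hm => ?_, key⟩
  · refine continuous_iff_continuousAt.2 fun x => ?_
    refine Filter.Tendsto.congr' (f₁ := fun _ => (u x (m + 1)).2 m) ?_ tendsto_const_nhds
    filter_upwards [(PiNat.isOpen_cylinder (fun _ => Bool) x (m + 1)).mem_nhds
      (PiNat.self_mem_cylinder x _)] with y hy
    refine (key y (m + 1) _ (hu x _) (fun k hk => ?_) m m.lt_succ_self).symm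
    exact (hux x _ k hk).trans (PiNat.mem_cylinder_iff.1 hy k hk).symm
  · exact ((hg _ (hu x _)).1 m hm).symm.trans (hux x _ m m.lt_succ_self)

theorem IsPartialIsometryOver.exists_homeomorph {C : Set ℕ}
    {g : Set ((ℕ → Bool) × (ℕ → Bool))} (hg : IsPartialIsometryOver C g)
    (hd : Dense (Prod.fst '' g)) (hr : Dense (Prod.snd '' g)) :
    ∃ h : (ℕ → Bool) ≃ₜ (ℕ → Bool), (∀ x, ∀ m ∈ C, h x m = x m) ∧ ∀ u ∈ g, h u.1 = u.2 := by
  obtain ⟨f, hfc, hfC, hf⟩ := hg.exists_extension hd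
  obtain ⟨f', hfc', -, hf'⟩ := hg.preimage_swap.exists_extension (by
    convert hr using 1
    ext x
    simp)
  have hd' : ∀ (x : ℕ → Bool) (n : ℕ), ∃ u ∈ g, ∀ m < n, u.1 m = x m := fun x n => by
    obtain ⟨_, ⟨u, hu, rfl⟩, hux⟩ := hd.exists_agree x n
    exact ⟨u, hu, hux⟩
  have hr' : ∀ (x : ℕ → Bool) (n : ℕ), ∃ u ∈ g, ∀ m < n, u.2 m = x m := fun x n => by
    obtain ⟨_, ⟨u, hu, rfl⟩, hux⟩ := hr.exists_agree x n
    exact ⟨u, hu, hux⟩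
  refine ⟨⟨⟨f, f', fun x => ?_, fun x => ?_⟩, hfc, hfc'⟩, hfC, fun u hu => ?_⟩
  · funext n
    obtain ⟨u, hu, hux⟩ := hd' x (n + 1)
    rw [hf' (f x) (n + 1) u.swap hu (fun m hm => (hf x _ u hu hux m hm).symm) n n.lt_succ_self]
    exact hux n n.lt_succ_self
  · funext n
    obtain ⟨u, hu, hux⟩ := hr' x (n + 1)
    rw [hf (f' x) (n + 1) u hu (fun m hm => (hf' x _ u.swap hu hux m hm).symm) n n.lt_succ_self]
    exact hux n n.lt_succ_self
  · funext n
    exact hf u.1 (n + 1) u hu (fun _ _ => rfl) n n.lt_succ_self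

theorem Filter.isCountableDenseHomogeneous_toCantorSet {F : Filter ℕ}
    (hF : F ≤ Filter.cofinite) (hT : F.AvoidsIntervals) (hP : F.IsPFilter) :
    IsCountableDenseHomogeneous F.toCantorSet := by
  refine ⟨inferInstance, fun D E hDc hDd hEc hEd => ?_⟩
  have hdense : ∀ {S : Set F.toCantorSet}, Dense S → Dense (Subtype.val '' S) := fun hS =>
    (Filter.dense_toCantorSet hF).denseRange_val.dense_image continuous_subtype_val hS
  obtain ⟨C, hC, hfib⟩ := F.exists_mem_forall_fiber_dense hT hP
    (D := fun i : Bool => cond i (Subtype.val '' D) (Subtype.val '' E))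
    (by
      rintro (_ | _) _ ⟨x, -, rfl⟩
      · exact x.2
      · exact x.2)
    (by
      rintro (_ | _)
      · exact hEc.image _
      · exact hDc.image _)
    (by
      rintro (_ | _)
      · exact hdense hEd
      · exact hdense hDd)
  obtain ⟨g, hg, hgD, hgE⟩ := exists_isPartialIsometryOver (hDc.image Subtype.val)
    (hEc.image Subtype.val) (hfib true false) (hfib false true)
  obtain ⟨h, hhC, hgh⟩ := hg.exists_homeomorph (hgD.symm ▸ hdense hDd) (hgE.symm ▸ hdense hEd)
  have hmem : ∀ x, x ∈ F.toCantorSet ↔ h x ∈ F.toCantorSet := fun x => by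
    refine Filter.congr_sets (Filter.mem_of_superset hC fun m hm => ?_)
    change x m = true ↔ h x m = true
    rw [hhC x m hm]
  refine ⟨h.subtype hmem, Subtype.val_injective.image_injective ?_⟩
  rw [← hgE]
  ext e
  constructor
  · rintro ⟨_, ⟨d, hd, rfl⟩, rfl⟩
    obtain ⟨u, hu, hud⟩ := (hgD.symm ▸ Set.mem_image_of_mem _ hd : d.1 ∈ Prod.fst '' g)
    refine ⟨u, hu, (hgh u hu).symm.trans ?_⟩
    rw [hud]
    rfl
  · rintro ⟨u, hu, rfl⟩
    obtain ⟨d, hd, hdu⟩ := (hgD ▸ Set.mem_image_of_mem _ hu : u.1 ∈ Subtype.val '' D)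
    refine ⟨_, ⟨d, hd, rfl⟩, ?_⟩
    change h d.1 = u.2
    rw [hdu, hgh u hu]

/-! ### Countable dense homogeneity implies non-meagerness -/

/-- The `n`-th term approximates a term of a dense sequence while avoiding the finitely many `T k`
with `k ≤ n`; each `T k` thus contains only terms of index below `k`. -/
theorem Filter.exists_dense_range_forall_notMem {F : Filter ℕ} (hF : F ≤ Filter.cofinite)
    {T : ℕ → Set (ℕ → Bool)} (hTc : ∀ n, IsClosed (T n)) (hTn : ∀ n, IsNowhereDense (T n)) :
    ∃ d : ℕ → F.toCantorSet, DenseRange d ∧ ∀ k n, k ≤ n → (d n).1 ∉ T k := by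
  have hne : Nonempty F.toCantorSet := (Filter.dense_toCantorSet hF).nonempty.to_subtype
  obtain ⟨a, ha⟩ := TopologicalSpace.exists_dense_seq F.toCantorSet
  have hstep : ∀ n : ℕ, ∃ x : F.toCantorSet, (∀ m < n.unpair.2, x.1 m = (a n.unpair.1).1 m) ∧
      ∀ k ≤ n, x.1 ∉ T k := by
    intro n
    have hU : Dense (⋂ k ∈ Set.Iic n, (T k)ᶜ) := by
      refine dense_biInter_of_isOpen (fun k _ => (hTc k).isOpen_compl) (Set.to_countable _)
        fun k _ => ?_
      rw [← interior_eq_empty_iff_dense_compl]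
      exact (hTc k).isNowhereDense_iff.1 (hTn k)
    have hUo : IsOpen (⋂ k ∈ Set.Iic n, (T k)ᶜ) :=
      (Set.finite_Iic n).isOpen_biInter fun k _ => (hTc k).isOpen_compl
    obtain ⟨x, ⟨hx, hxT⟩, hxF⟩ := (Filter.dense_toCantorSet hF).inter_open_nonempty _
      ((PiNat.isOpen_cylinder (fun _ => Bool) (a n.unpair.1).1 n.unpair.2).inter hUo)
      (hU.inter_open_nonempty _ (PiNat.isOpen_cylinder _ _ _) ⟨_, PiNat.self_mem_cylinder _ _⟩)
    exact ⟨⟨x, hxF⟩, PiNat.mem_cylinder_iff.1 hx, fun k hk => Set.mem_iInter₂.1 hxT k hk⟩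
  choose d hda hdT using hstep
  refine ⟨d, dense_iff_inter_open.2 fun U hU hUne => ?_, fun k n hk => hdT n k hk⟩
  obtain ⟨V, hV, rfl⟩ := isOpen_induced_iff.1 hU
  obtain ⟨_, haV, i, rfl⟩ := ha.inter_open_nonempty _ hU hUne
  obtain ⟨n, hn⟩ := hV.exists_agree_subset haV
  exact ⟨d (Nat.pair i n), hn _ (by simpa using hda (Nat.pair i n)), _, rfl⟩

theorem IsCountableDenseHomogeneous.not_isMeagre {F : Filter ℕ} (hF : F ≤ Filter.cofinite)
    {B : Set ℕ} (hB : B ∈ F) (hBc : Bᶜ.Infinite)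
    (h : IsCountableDenseHomogeneous F.toCantorSet) : ¬ IsMeagre F.toCantorSet := by
  classical
  intro hm
  obtain ⟨S, hSn, hSc, hS⟩ := isMeagre_iff_countable_union_isNowhereDense.1 hm
  obtain ⟨T', hT'⟩ := (hSc.insert ∅).exists_eq_range (Set.insert_nonempty _ _)
  let T : ℕ → Set (ℕ → Bool) := fun n => closure (T' n)
  have hTn : ∀ n, IsNowhereDense (T n) := fun n => by
    have hn : T' n ∈ insert ∅ S := hT'.symm ▸ Set.mem_range_self n
    rcases hn with hn | hn
    · rw [show T n = ∅ by simp [T, hn]]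
      exact isNowhereDense_empty
    · exact (hSn _ hn).closure
  have hFT : ∀ x ∈ F.toCantorSet, ∃ n, x ∈ T n := fun x hx => by
    obtain ⟨s, hs, hxs⟩ := hS hx
    obtain ⟨n, rfl⟩ := (hT' ▸ Set.mem_insert_of_mem _ hs : s ∈ Set.range T')
    exact ⟨n, subset_closure hxs⟩
  obtain ⟨d, hd, hdT⟩ := F.exists_dense_range_forall_notMem hF (fun n => isClosed_closure) hTn
  let φ : (ℕ → Bool) → F.toCantorSet := fun y => ⟨fun n => if n ∈ B then true else y n,
    Filter.mem_of_superset hB fun n hn => if_pos hn⟩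
  have hφ : Continuous φ := by
    refine Continuous.subtype_mk (continuous_pi fun n => ?_) _
    by_cases hn : n ∈ B
    · simpa only [if_pos hn] using continuous_const
    · simpa only [if_neg hn] using continuous_apply n
  let q : Finset ℕ → F.toCantorSet := fun s => φ fun n => decide (n ∈ s)
  obtain ⟨g, hg⟩ := h.2 (Set.range d ∪ Set.range q) (Set.range d)
    ((Set.countable_range d).union (Set.countable_range q)) (hd.mono Set.subset_union_left)
    (Set.countable_range d) hd
  -- Baire on the Cantor set parametrized by `φ`: some `T k` absorbs the image of an open piece,
  -- hence infinitely many points of `range d`.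
  obtain ⟨k, x, hx⟩ := nonempty_interior_of_iUnion_of_closed
    (f := fun k => {y | (g (φ y)).1 ∈ T k})
    (fun k => isClosed_closure.preimage
      (continuous_subtype_val.comp (g.continuous.comp hφ)))
    (Set.eq_univ_of_forall fun y => Set.mem_iUnion.2 (hFT _ (g (φ y)).2))
  obtain ⟨n, hn⟩ := isOpen_interior.exists_agree_subset hx
  let s : Finset ℕ := (Finset.range n).filter fun m => x m = true
  have hinf : (Bᶜ \ Set.Iio n).Infinite := hBc.sdiff (Set.finite_Iio n)
  have hfin : (d '' Set.Iio k).Finite := (Set.finite_Iio k).image d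
  refine hinf (Set.Finite.of_injOn (f := fun j => g (q (insert j s))) (fun j hj => ?_) ?_ hfin)
  · have hmem : g (q (insert j s)) ∈ Set.range d := hg ▸ ⟨_, Or.inr ⟨_, rfl⟩, rfl⟩
    obtain ⟨i, hi⟩ := hmem
    refine ⟨i, not_le.1 fun hki => hdT k i hki ?_, hi⟩
    rw [hi]
    refine interior_subset (s := {y | (g (φ y)).1 ∈ T k})
      (hn (fun m => decide (m ∈ insert j s)) fun m hm => ?_)
    have hmj : m ≠ j := fun hmj => hj.2 (hmj ▸ hm)
    cases hxm : x m <;> simp [s, hmj, hm, hxm]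
  · intro i hi j hj hij
    have hq := congrFun (congrArg Subtype.val (g.injective hij)) i
    have hiB : i ∉ B := hi.1
    have his : i ∉ s := fun his => hi.2 (Finset.mem_range.1 (Finset.mem_filter.1 his).1)
    simpa [q, φ, hiB, his] using hq

/-! ### Countable dense homogeneity implies the `P`-property -/

theorem Filter.exists_rank_of_not_isPFilter {F : Filter ℕ} (hF : F ≤ Filter.cofinite)
    (hP : ¬ F.IsPFilter) :
    ∃ r : ℕ → ℕ, (∀ n, {m | n ≤ r m} ∈ F) ∧ ∀ B ∈ F, ∃ n, {m ∈ B | r m = n}.Infinite := by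
  classical
  unfold Filter.IsPFilter at hP
  push Not at hP
  obtain ⟨A, hA, hAB⟩ := hP
  -- The cap at `m` keeps ranks finite and costs only finitely many points of each `{m | n ≤ r m}`.
  let r : ℕ → ℕ := fun m => Nat.findGreatest (fun n => ∀ k < n, m ∈ A k) m
  have hr : ∀ n m, n ≤ m → (∀ k < n, m ∈ A k) → n ≤ r m := fun n m hnm h =>
    Nat.le_findGreatest hnm h
  have hr' : ∀ m, ∀ k < r m, m ∈ A k := fun m =>
    Nat.findGreatest_spec (P := fun n => ∀ k < n, m ∈ A k) (Nat.zero_le m) (by simp)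
  refine ⟨r, fun n => ?_, fun B hB => ?_⟩
  · filter_upwards [(Filter.biInter_mem (Set.finite_Iio n)).2 fun k _ => hA k,
      Filter.mem_of_forall_ge hF (A := Set.Ici n) fun m hm => hm] with m hm hnm
    exact hr n m hnm fun k hk => Set.mem_iInter₂.1 hm k hk
  · obtain ⟨n, hn⟩ := hAB B hB
    by_contra! hfin
    refine hn (((Set.finite_Iic n).biUnion fun i _ => hfin i).subset ?_)
    rintro m ⟨hmB, hmA⟩
    exact Set.mem_iUnion₂.2 ⟨r m, not_lt.1 fun hlt => hmA (hr' m n hlt), hmB, rfl⟩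

/-- A filter that is not a `P`-filter contains a nonempty countable crowded closed set. -/
theorem Filter.exists_countable_crowded_of_not_isPFilter {F : Filter ℕ}
    (hF : F ≤ Filter.cofinite) (hP : ¬ F.IsPFilter) :
    ∃ Q : Set F.toCantorSet, Q.Nonempty ∧ Q.Countable ∧ IsClosed Q ∧ Preperfect Q := by
  classical
  obtain ⟨r, hr, hrB⟩ := F.exists_rank_of_not_isPFilter hF hP
  -- A point of `x` forces all earlier points of at least its rank. Infinitely many points of rank
  -- `n` thus force everything of rank at least `n`; with `n` least, `x` is determined by `n` and a
  -- finite set.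
  let K : Set (ℕ → Bool) := {x | ∀ m m', m' ≤ m → r m ≤ r m' → x m = true → x m' = true}
  have hdec : ∀ x ∈ K, x ∈ F.toCantorSet → ∃ n, {m | x m = true ∧ r m = n}.Infinite ∧
      (∀ i < n, {m | x m = true ∧ r m = i}.Finite) ∧ ∀ m, n ≤ r m → x m = true := by
    intro x hx hxF
    have hex : ∃ n, {m | x m = true ∧ r m = n}.Infinite := hrB _ hxF
    refine ⟨Nat.find hex, Nat.find_spec hex, fun i hi => Set.not_infinite.1 (Nat.find_min hex hi),
      fun m hm => ?_⟩
    obtain ⟨m₁, ⟨hm₁, hrm₁⟩, hlt⟩ := (Nat.find_spec hex).exists_gt m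
    exact hx m₁ m hlt.le (hrm₁.trans_le hm) hm₁
  refine ⟨Subtype.val ⁻¹' K, ⟨⟨fun _ => true, Filter.univ_mem' fun _ => rfl⟩,
    fun _ _ _ _ _ => rfl⟩, ?_, ?_, ?_⟩
  · have hc : (⋃ n : ℕ, Set.range fun s : Finset ℕ => fun m =>
        decide (m ∈ s ∨ n ≤ r m)).Countable :=
      Set.countable_iUnion fun n => Set.countable_range _
    refine (hc.preimage Subtype.val_injective).mono fun x hx => ?_
    obtain ⟨n, -, hfin, hall⟩ := hdec x.1 hx x.2
    have hfin' : {m | x.1 m = true ∧ r m < n}.Finite := by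
      refine ((Set.finite_Iio n).biUnion fun i hi => hfin i hi).subset fun m hm => ?_
      exact Set.mem_iUnion₂.2 ⟨r m, hm.2, hm.1, rfl⟩
    refine Set.mem_iUnion.2 ⟨n, hfin'.toFinset, ?_⟩
    funext m
    by_cases hm : n ≤ r m
    · simp [hm, hall m hm]
    · simp [hm, not_le.1 hm]
  · refine IsClosed.preimage continuous_subtype_val ?_
    have hK : K = ⋂ (m : ℕ) (m' : ℕ) (_ : m' ≤ m) (_ : r m ≤ r m'),
        {x | x m = true → x m' = true} := by
      ext x
      simp [K]
    rw [hK]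
    refine isClosed_iInter fun m => isClosed_iInter fun m' => isClosed_iInter fun _ =>
      isClosed_iInter fun _ => ?_
    have hc : Continuous fun x : ℕ → Bool => (x m, x m') :=
      (continuous_apply m).prodMk (continuous_apply m')
    exact (isClosed_discrete {b : Bool × Bool | b.1 = true → b.2 = true}).preimage hc
  · intro x hx
    obtain ⟨n, hinf, hfin, hall⟩ := hdec x.1 hx x.2
    rw [accPt_iff_nhds]
    intro U hU
    obtain ⟨V', hV', hxV'⟩ := mem_nhds_induced _ _ _ |>.1 hU
    obtain ⟨V, hVV', hV, hxV⟩ := mem_nhds_iff.1 hV'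
    obtain ⟨l, hl⟩ := hV.exists_agree_subset hxV
    have hfin' : {m | x.1 m = true ∧ r m < n}.Finite := by
      refine ((Set.finite_Iio n).biUnion fun i hi => hfin i hi).subset fun m hm => ?_
      exact Set.mem_iUnion₂.2 ⟨r m, hm.2, hm.1, rfl⟩
    obtain ⟨b, hb⟩ := hfin'.bddAbove
    -- `y` deletes from `x` the points of rank `n` from `k` on, of which there are infinitely many;
    -- `b + 1` protects all points of lower rank.
    let k := max l (b + 1)
    let y : ℕ → Bool := fun m => decide ((x.1 m = true ∧ m < k) ∨ n + 1 ≤ r m)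
    have hy : ∀ m, y m = true ↔ (x.1 m = true ∧ m < k) ∨ n + 1 ≤ r m := fun m =>
      decide_eq_true_iff
    have hyF : y ∈ F.toCantorSet := Filter.mem_of_superset (hr (n + 1)) fun m hm =>
      (hy m).2 (Or.inr hm)
    have hyK : y ∈ K := by
      intro m m' hmm hrm hym
      rw [hy] at hym ⊢
      rcases hym with ⟨hxm, hmk⟩ | hm
      · exact Or.inl ⟨hx m m' hmm hrm hxm, hmm.trans_lt hmk⟩
      · exact Or.inr (hm.trans hrm)
    refine ⟨⟨y, hyF⟩, ⟨hxV' (hVV' (hl y fun m hm => ?_)), hyK⟩, fun hyx => ?_⟩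
    · have hmk : m < k := hm.trans_le (le_max_left _ _)
      rw [Bool.eq_iff_iff, hy]
      refine ⟨?_, fun hxm => Or.inl ⟨hxm, hmk⟩⟩
      rintro (h | h)
      · exact h.1
      · exact hall m (by omega)
    · obtain ⟨m, ⟨hxm, hrm⟩, hkm⟩ := hinf.exists_gt k
      have hym : y m = true := (congrFun (congrArg Subtype.val hyx) m).trans hxm
      rw [hy] at hym
      omega

/-- In a filter that avoids intervals, each nonempty crowded family of cofinite sets has a limit
that is not cofinite. -/
theorem Filter.AvoidsIntervals.not_isClosed {F : Filter ℕ} (hT : F.AvoidsIntervals)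
    (hF : F ≤ Filter.cofinite) {Q : Set F.toCantorSet} (hne : Q.Nonempty) (hQ : Preperfect Q)
    (hcof : ∀ x ∈ Q, ∃ N, ∀ m, N ≤ m → x.1 m = true) : ¬ IsClosed Q := by
  classical
  intro hcl
  have hsucc : ∀ (N : ℕ) (x : F.toCantorSet), ∃ y : F.toCantorSet, x ∈ Q →
      y ∈ Q ∧ y ≠ x ∧ ∀ m < N, y.1 m = x.1 m := by
    intro N x
    by_cases hx : x ∈ Q
    · obtain ⟨y, ⟨hy, hyQ⟩, hyx⟩ := accPt_iff_nhds.1 (hQ x hx) _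
        (((PiNat.isOpen_cylinder (fun _ => Bool) x.1 N).preimage
          continuous_subtype_val).mem_nhds (PiNat.self_mem_cylinder x.1 N))
      exact ⟨y, fun _ => ⟨hyQ, hyx, PiNat.mem_cylinder_iff.1 hy⟩⟩
    · exact ⟨x, fun h => absurd h hx⟩
  choose f hf using hsucc
  have hg : ∀ N : ℕ, ∃ M, ∀ x ∈ Q, (∀ m, N ≤ m → x.1 m = true) →
      ∀ m, M ≤ m → (f N x).1 m = true := by
    intro N
    have hfin : {x : F.toCantorSet | x ∈ Q ∧ ∀ m, N ≤ m → x.1 m = true}.Finite :=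
      ((finite_setOf_forall_ge true N).preimage Subtype.val_injective.injOn).subset
        fun x hx => hx.2
    choose! b hb using hcof
    obtain ⟨M, hM⟩ := (hfin.image fun x => b (f N x)).bddAbove
    exact ⟨M, fun x hx hxN m hm =>
      hb _ (hf N x hx).1 m ((hM ⟨x, ⟨hx, hxN⟩, rfl⟩).trans hm)⟩
  choose g hg using hg
  obtain ⟨A, hA, hAg⟩ := hT g
  choose ν hν hνA using hAg
  obtain ⟨x₀, hx₀⟩ := hne
  obtain ⟨p₀, hp₀⟩ := hcof x₀ hx₀
  -- New zeros can appear only in `[ν, g ν)`, which `A` misses, so the limit still contains a tail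
  -- of `A`. The `+ 1` drives the stages to infinity.
  let step : ℕ × F.toCantorSet → ℕ × F.toCantorSet := fun s =>
    (max (g (ν s.1)) (ν s.1 + 1), f (ν s.1) s.2)
  let σ : ℕ → ℕ × F.toCantorSet := fun k => step^[k] (p₀, x₀)
  have hσ : ∀ k, σ (k + 1) = step (σ k) := fun k => Function.iterate_succ_apply' _ _ _
  have hinv : ∀ k, (σ k).2 ∈ Q ∧ ∀ m, (σ k).1 ≤ m → (σ k).2.1 m = true := by
    intro k
    induction k with
    | zero => exact ⟨hx₀, hp₀⟩
    | succ k ih =>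
      rw [hσ]
      exact ⟨(hf _ _ ih.1).1, fun m hm => hg _ _ ih.1
        (fun j hj => ih.2 j ((hν _).trans hj)) m ((le_max_left _ _).trans hm)⟩
  have hlt : ∀ k, ν (σ k).1 < (σ (k + 1)).1 := fun k => by
    rw [hσ]
    exact Nat.lt_of_succ_le (le_max_right _ _)
  have hk : ∀ k, k ≤ (σ k).1 := by
    intro k
    induction k with
    | zero => exact Nat.zero_le _
    | succ k ih => exact (ih.trans (hν _)).trans_lt (hlt k)
  have hagree : ∀ k l, k ≤ l → ∀ m < ν (σ k).1, (σ l).2.1 m = (σ k).2.1 m := by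
    intro k l hkl
    induction l, hkl using Nat.le_induction with
    | base => exact fun _ _ => rfl
    | succ l hkl ih =>
      intro m hm
      rw [← ih m hm, hσ]
      refine (hf _ _ (hinv l).1).2.2 m (hm.trans_le ?_)
      have hmono : Monotone fun k => ν (σ k).1 :=
        monotone_nat_of_le_succ fun k => (hlt k).le.trans (hν _)
      exact hmono hkl
  have hAσ : ∀ k, ∀ m ∈ A, p₀ ≤ m → (σ k).2.1 m = true := by
    intro k
    induction k with
    | zero => exact fun m _ hm => hp₀ m hm
    | succ k ih =>
      intro m hm hpm
      by_cases hmν : m < ν (σ k).1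
      · rw [hagree k (k + 1) k.le_succ m hmν]
        exact ih m hm hpm
      · rw [hσ]
        exact hg _ _ (hinv k).1 (fun j hj => (hinv k).2 j ((hν _).trans hj)) m
          (hνA _ m hm (not_lt.1 hmν))
  let y : ℕ → Bool := fun m => (σ (m + 1)).2.1 m
  have hy : ∀ k, ∀ m < ν (σ k).1, y m = (σ k).2.1 m := by
    intro k m hm
    have hm' : m < ν (σ (m + 1)).1 := ((Nat.lt_succ_self m).trans_le (hk _)).trans_le (hν _)
    rcases le_total k (m + 1) with h | h
    · exact hagree _ _ h m hm
    · exact (hagree _ _ h m hm').symm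
  have hyF : y ∈ F.toCantorSet := by
    refine Filter.mem_of_superset (Filter.inter_mem hA
      (Filter.mem_of_forall_ge hF (A := Set.Ici p₀) fun m hm => hm)) fun m hm => ?_
    exact hAσ _ m hm.1 hm.2
  have hyQ : (⟨y, hyF⟩ : F.toCantorSet) ∈ Q := by
    refine hcl.closure_subset (mem_closure_iff_nhds.2 fun U hU => ?_)
    obtain ⟨V', hV', hVU⟩ := mem_nhds_induced _ _ _ |>.1 hU
    obtain ⟨V, hVV', hV, hyV⟩ := mem_nhds_iff.1 hV'
    obtain ⟨l, hl⟩ := hV.exists_agree_subset hyV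
    refine ⟨(σ l).2, hVU (hVV' (hl _ fun m hm => ?_)), (hinv l).1⟩
    exact (hy l m (hm.trans_le ((hk l).trans (hν _)))).symm
  -- Step `N` creates a zero at a place at least `N`, and later steps preserve it, so the limit `y`
  -- cannot be one from `N` on.
  obtain ⟨N, hN⟩ := hcof _ hyQ
  obtain ⟨-, hne, hag⟩ := hf (ν (σ N).1) _ (hinv N).1
  refine hne (Subtype.ext (funext fun m => ?_))
  by_cases hm : m < ν (σ N).1
  · exact hag m hm
  · have hm' : ν (σ N).1 ≤ m := not_lt.1 hm
    rw [(hinv N).2 m ((hν _).trans hm')]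
    by_cases hmg : g (ν (σ N).1) ≤ m
    · exact hg _ _ (hinv N).1 (fun j hj => (hinv N).2 j ((hν _).trans hj)) m hmg
    · have h₁ := hy (N + 1) m (by
        refine lt_of_lt_of_le ?_ (hν _)
        rw [hσ]
        exact lt_max_of_lt_left (not_le.1 hmg))
      rw [hσ] at h₁
      exact h₁.symm.trans (hN m (((hk N).trans (hν _)).trans hm'))

theorem IsCountableDenseHomogeneous.isPFilter {F : Filter ℕ} (hF : F ≤ Filter.cofinite)
    (hT : F.AvoidsIntervals) (h : IsCountableDenseHomogeneous F.toCantorSet) : F.IsPFilter := by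
  by_contra hP
  obtain ⟨Q, hne, hQc, hQcl, hQ⟩ := F.exists_countable_crowded_of_not_isPFilter hF hP
  let D : Set F.toCantorSet := {x | ∃ N, ∀ m, N ≤ m → x.1 m = true}
  have hDc : D.Countable := (countable_eventually_eq true).preimage Subtype.val_injective
  have hD : Dense D := by
    refine dense_iff_inter_open.2 fun U hU hUne => ?_
    obtain ⟨V, hV, rfl⟩ := isOpen_induced_iff.1 hU
    obtain ⟨x, hx⟩ := hUne
    obtain ⟨n, hn⟩ := hV.exists_agree_subset hx
    have hge : ∀ m, n ≤ m → (if m < n then x.1 m else true) = true := fun m hm =>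
      if_neg (not_lt.2 hm)
    exact ⟨⟨fun m => if m < n then x.1 m else true, Filter.mem_of_forall_ge hF hge⟩,
      hn _ fun m hm => if_pos hm, n, hge⟩
  obtain ⟨g, hg⟩ := h.2 (D ∪ Q) D (hDc.union hQc) (hD.mono Set.subset_union_left) hDc hD
  refine hT.not_isClosed hF (Q := g '' Q) (hne.image g) ?_ ?_ (g.isClosed_image.2 hQcl)
  · rintro _ ⟨x, hx, rfl⟩
    rw [accPt_iff_nhds]
    intro U hU
    obtain ⟨z, ⟨hzU, hzQ⟩, hzx⟩ := accPt_iff_nhds.1 (hQ x hx) _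
      (g.continuous.continuousAt.preimage_mem_nhds hU)
    exact ⟨g z, ⟨hzU, z, hzQ, rfl⟩, g.injective.ne hzx⟩
  · rintro _ ⟨x, hx, rfl⟩
    exact (hg ▸ ⟨x, Or.inr hx, rfl⟩ : g x ∈ D)

theorem mainTheorem4 (F : Filter ℕ) (hproper : F.NeBot) (hfree : F ≤ Filter.cofinite) :
    IsCountableDenseHomogeneous (Cp (Xi F) (ℕ → Bool)) ↔
      ¬ IsMeagre F.toCantorSet ∧ F.IsPFilter := by
  have hfree' := Filter.columns_le_cofinite hfree
  constructor
  · intro h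
    replace h := h.of_homeomorph (cpHomeomorph F)
    have hm := h.not_isMeagre hfree' F.range_mem_columns infinite_compl_range_columnIndex
    exact ⟨fun hF => hm (Filter.isMeagre_columns hF),
      (h.isPFilter hfree' (Filter.avoidsIntervals_of_not_isMeagre hm)).of_columns⟩
  · rintro ⟨hm, hP⟩
    exact (Filter.isCountableDenseHomogeneous_toCantorSet hfree'
      ((Filter.avoidsIntervals_of_not_isMeagre hm).columns hfree) (hP.columns hfree)).of_homeomorph
      (cpHomeomorph F).symm
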